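/- Let $\Gamma$ be a countable discrete group and let $\Lambda\le\Gamma$ be a non-amenable subgroup. For an action of $\Lambda$ on a set $X$ let $\pi_X$ denote the permutation representation of $\Lambda$ on $\ell^2(X)$, $(\pi_X(g)\xi)(x)=\xi(g^{-1}x)$. Consider the left translation action of $\Lambda$ on $\Gamma/\Lambda$ and the associated Calkin representation $\Lambda\to\mathbb{B}(\ell^2(\Gamma/\Lambda))/\mathbb{K}(\ell^2(\Gamma/\Lambda))$, that is, $\pi_{\Gamma/\Lambda}$ followed by the quotient by the compact operators. Suppose that it is tempered, i.e. that the induced $*$-homomorphism $C^*(\Lambda)\to\mathbb{B}(\ell^2(\Gamma/\Lambda))/\mathbb{K}(\ell^2(\Gamma/\Lambda))$ factors through the canonical surjection $C^*(\Lambda)\to C^*_\lambda(\Lambda)$ onto the reduced group $C^*$-algebra. Then $\Lambda$ has the spectral gap property in $\Gamma$, i.e. the representation $\pi_X$ of $\Lambda$ on $\ell^2(X)$, $X=(\Gamma/\Lambda)\setminus\{e\Lambda\}$, does not weakly contain the trivial representation, if and only if for every $g\in\Gamma\setminus\Lambda$ the orbit $\Lambda(g\Lambda)\subseteq\Gamma/\Lambda$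 is infinite. -/

import Mathlib

/-! ### Amenability of a discrete group -/

/-- A discrete group `G` is amenable if it carries a finitely additive probability measure,
defined on all subsets of `G`, which is invariant under left translations. -/
def IsAmenableGroup (G : Type*) [Group G] : Prop :=
  ∃ m : Set G → ℝ,
    (∀ A, 0 ≤ m A) ∧ m Set.univ = 1 ∧
    (∀ A B, Disjoint A B → m (A ∪ B) = m A + m B) ∧
    (∀ (g : G) (A : Set G), m ((fun x => g * x) '' A) = m A)

/-! ### Permutation representations on `ℓ²` -/

/-- The Hilbert space `ℓ²(X)` of square-summable complex functions on a set `X`. -/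
abbrev EllTwo (X : Type*) : Type _ := lp (fun _ : X => ℂ) 2

theorem memEllTwo_comp {X : Type*} (e : Equiv.Perm X) {f : X → ℂ}
    (hf : Memℓp f 2) : Memℓp (fun x => f (e x)) 2 := by
  have h2 : 0 < (2 : ENNReal).toReal := by norm_num
  rw [memℓp_gen_iff h2] at hf ⊢
  exact (e.summable_iff (f := fun x => ‖f x‖ ^ (2 : ENNReal).toReal)).2 hf

/-- A permutation `e` of `X` gives the isometry `ξ ↦ ξ ∘ e⁻¹` of `ℓ²(X)`. -/
noncomputable def permIsometry {X : Type*} (e : Equiv.Perm X) :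
    EllTwo X ≃ₗᵢ[ℂ] EllTwo X where
  toFun ξ := ⟨fun x => ξ (e⁻¹ x), memEllTwo_comp e⁻¹ (lp.memℓp ξ)⟩
  invFun ξ := ⟨fun x => ξ (e x), memEllTwo_comp e (lp.memℓp ξ)⟩
  map_add' _ _ := by ext; rfl
  map_smul' _ _ := by ext; rfl
  left_inv ξ := by ext x; simp
  right_inv ξ := by ext x; simp
  norm_map' ξ := by
    have h2 : 0 < (2 : ENNReal).toReal := by norm_num
    rw [lp.norm_eq_tsum_rpow h2, lp.norm_eq_tsum_rpow h2]
    congr 1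
    exact (e⁻¹).tsum_eq (fun x => ‖ξ x‖ ^ (2 : ENNReal).toReal)

/-- The unitary representation of `G` on `ℓ²(X)` associated with an action of `G` on `X`:
`(g ξ)(x) = ξ (g⁻¹ x)`. -/
noncomputable def permRep (G X : Type*) [Group G] [MulAction G X] :
    G →* unitary (EllTwo X →L[ℂ] EllTwo X) :=
  (Unitary.linearIsometryEquiv (𝕜 := ℂ) (H := EllTwo X)).symm.toMonoidHom.comp
    { toFun := fun g => permIsometry (MulAction.toPerm g)
      map_one' := by
        ext ξ x
        change ξ ((MulAction.toPerm (1 : G))⁻¹ x) = ξ x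
        simp [Equiv.Perm.inv_def]
      map_mul' := fun g h => by
        ext ξ x
        change ξ ((MulAction.toPerm (g * h))⁻¹ x)
          = ξ ((MulAction.toPerm h)⁻¹ ((MulAction.toPerm g)⁻¹ x))
        simp [Equiv.Perm.inv_def, mul_smul] }

theorem permRep_apply {G X : Type*} [Group G] [MulAction G X] (g : G) (ξ : EllTwo X) (x : X) :
    (permRep G X g : EllTwo X →L[ℂ] EllTwo X) ξ x = ξ (g⁻¹ • x) := rfl

/-! ### The Calkin algebra -/

theorem isCompactOperator_adjoint {H : Type*} [NormedAddCommGroup H] [InnerProductSpace ℂ H]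
    [CompleteSpace H] {T : H →L[ℂ] H} (hT : IsCompactOperator T) :
    IsCompactOperator (star T : H →L[ℂ] H) := by
  have hTT : IsCompactOperator (T * star T : H →L[ℂ] H) := hT.comp_clm (star T)
  have hc := hTT.isCompact_closure_image_closedBall (1 : ℝ)
  have htb := hc.totallyBounded.subset subset_closure
  refine (isCompactOperator_iff_isCompact_closure_image_closedBall
    ((star T : H →L[ℂ] H) : H →ₗ[ℂ] H) (r := 1) one_pos).2 ?_
  refine TotallyBounded.isCompact_of_isClosed (TotallyBounded.closure ?_) isClosed_closure
  rw [Metric.totallyBounded_iff]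
  intro ε hε
  obtain ⟨t, hts, htf, htc⟩ :=
    Metric.finite_approx_of_totallyBounded htb (ε ^ 2 / 2) (by positivity)
  have hts' : ∀ y ∈ t, ∃ x, x ∈ Metric.closedBall (0 : H) 1 ∧ (T * star T : H →L[ℂ] H) x = y :=
    fun y hy => hts hy
  choose! p hp using hts'
  refine ⟨(fun y => (star T : H →L[ℂ] H) (p y)) '' t, htf.image _, ?_⟩
  rintro _ ⟨x, hx, rfl⟩
  have hx' := htc ⟨x, hx, rfl⟩
  simp only [Set.mem_iUnion, Metric.mem_ball, exists_prop] at hx' ⊢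
  obtain ⟨y, hy, hxy⟩ := hx'
  refine ⟨_, ⟨y, hy, rfl⟩, ?_⟩
  obtain ⟨hpb, hpy⟩ := hp y hy
  rw [dist_eq_norm] at hxy ⊢
  have hxy' : ‖T ((star T : H →L[ℂ] H) (x - p y))‖ < ε ^ 2 / 2 := by
    rw [← hpy] at hxy
    simpa [map_sub] using hxy
  have hn : ‖x - p y‖ ≤ 2 := by
    have h1 : ‖x‖ ≤ 1 := by simpa using hx
    have h2 : ‖p y‖ ≤ 1 := by simpa using hpb
    linarith [norm_sub_le x (p y)]
  have hsq : ‖(star T : H →L[ℂ] H) (x - p y)‖ ^ 2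
      ≤ ‖T ((star T : H →L[ℂ] H) (x - p y))‖ * ‖x - p y‖ := by
    have h := ContinuousLinearMap.adjoint_inner_right T
      ((star T : H →L[ℂ] H) (x - p y)) (x - p y)
    rw [← ContinuousLinearMap.star_eq_adjoint, inner_self_eq_norm_sq_to_K] at h
    have h2 := norm_inner_le_norm (𝕜 := ℂ) (T ((star T : H →L[ℂ] H) (x - p y))) (x - p y)
    rw [← h] at h2
    simpa using h2
  have hlt : ‖(star T : H →L[ℂ] H) (x - p y)‖ ^ 2 < ε ^ 2 := by
    nlinarith [norm_nonneg (T ((star T : H →L[ℂ] H) (x - p y)))]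
  have := lt_of_pow_lt_pow_left₀ 2 hε.le hlt
  simpa [map_sub] using this

/-- The closed two-sided ideal `𝕂(H)` of compact operators in `𝔹(H)`. -/
def compactIdeal (H : Type*) [NormedAddCommGroup H] [InnerProductSpace ℂ H] :
    Ideal (H →L[ℂ] H) where
  carrier := {T | IsCompactOperator T}
  add_mem' hS hT := IsCompactOperator.add hS hT
  zero_mem' := isCompactOperator_zero
  smul_mem' S _ hT := IsCompactOperator.clm_comp hT S

instance compactIdeal_isTwoSided (H : Type*) [NormedAddCommGroup H] [InnerProductSpace ℂ H] :
    (compactIdeal H).IsTwoSided :=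
  ⟨fun S hT => IsCompactOperator.comp_clm hT S⟩

/-- The Calkin algebra `𝔹(H) / 𝕂(H)`. -/
abbrev Calkin (H : Type*) [NormedAddCommGroup H] [InnerProductSpace ℂ H] : Type _ :=
  (H →L[ℂ] H) ⧸ compactIdeal H

/-- The involution of the Calkin algebra: `[T]* = [T*]`. -/
noncomputable instance calkinStarRing (H : Type*) [NormedAddCommGroup H] [InnerProductSpace ℂ H]
    [CompleteSpace H] : StarRing (Calkin H) where
  star := Quotient.lift (fun T : H →L[ℂ] H => Ideal.Quotient.mk (compactIdeal H) (star T))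
    (fun S T h => by
      have h' : S - T ∈ compactIdeal H := (Submodule.quotientRel_def _).1 h
      refine Ideal.Quotient.eq.2 ?_
      rw [← star_sub]
      exact isCompactOperator_adjoint h')
  star_involutive := by
    intro x
    obtain ⟨T, rfl⟩ := Ideal.Quotient.mk_surjective x
    exact congrArg (Ideal.Quotient.mk (compactIdeal H)) (star_star T)
  star_mul := by
    intro x y
    obtain ⟨S, rfl⟩ := Ideal.Quotient.mk_surjective x
    obtain ⟨T, rfl⟩ := Ideal.Quotient.mk_surjective y
    exact congrArg (Ideal.Quotient.mk (compactIdeal H)) (star_mul S T)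
  star_add := by
    intro x y
    obtain ⟨S, rfl⟩ := Ideal.Quotient.mk_surjective x
    obtain ⟨T, rfl⟩ := Ideal.Quotient.mk_surjective y
    exact congrArg (Ideal.Quotient.mk (compactIdeal H)) (star_add S T)

/-- The quotient map `𝔹(H) → 𝔹(H) / 𝕂(H)`. -/
noncomputable def calkinMk (H : Type*) [NormedAddCommGroup H] [InnerProductSpace ℂ H]
    [CompleteSpace H] : (H →L[ℂ] H) →⋆ₐ[ℂ] Calkin H :=
  { Ideal.Quotient.mkₐ ℂ (compactIdeal H) with
    map_star' := fun _ => rfl }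

/-- The Calkin representation of `G` associated with an action of `G` on `X`: the composition of
the permutation representation on `ℓ²(X)` with the quotient map onto the Calkin algebra. -/
noncomputable def calkinRep (G X : Type*) [Group G] [MulAction G X] :
    G →* unitary (Calkin (EllTwo X)) :=
  (Unitary.map
    { (calkinMk (EllTwo X) : (EllTwo X →L[ℂ] EllTwo X) →* Calkin (EllTwo X)) with
      map_star' := map_star (calkinMk (EllTwo X)) }).toMonoidHom.comp (permRep G X)

theorem calkinRep_apply {G X : Type*} [Group G] [MulAction G X] (g : G) :
    (calkinRep G X g : Calkin (EllTwo X)) = calkinMk (EllTwo X) (permRep G X g) := rfl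

/-! ### Temperedness -/

/-- The reduced group C*-algebra `C*_λ(G)`: the norm closed *-subalgebra of `𝔹(ℓ²(G))` generated by
the left regular representation `(λ(g) ξ)(x) = ξ(g⁻¹ x)`. -/
noncomputable def reducedCStar (G : Type*) [Group G] :
    StarSubalgebra ℂ (EllTwo G →L[ℂ] EllTwo G) :=
  (StarAlgebra.adjoin ℂ
    (Set.range fun g : G => (permRep G G g : EllTwo G →L[ℂ] EllTwo G))).topologicalClosure

/-- The element `λ(g)` of `C*_λ(G)`. -/
noncomputable def reducedCStar.of {G : Type*} [Group G] (g : G) : reducedCStar G :=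
  ⟨(permRep G G g : EllTwo G →L[ℂ] EllTwo G),
    StarSubalgebra.le_topologicalClosure _ (StarAlgebra.subset_adjoin ℂ _ ⟨g, rfl⟩)⟩

/-- A unitary representation `u` of `G` in a unital *-algebra `A` is tempered if it factors through
the reduced group C*-algebra, i.e. there is a *-homomorphism `C*_λ(G) → A` with `λ(g) ↦ u(g)`.
Since `C*(G)` is generated by the group elements, for a C*-algebra `A` this says that the
*-homomorphism `C*(G) → A` induced by `u` factors through the canonical surjection
`C*(G) → C*_λ(G)`. -/
def IsTemperedRep {G A : Type*} [Group G] [Ring A] [StarRing A] [Algebra ℂ A]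
    (u : G →* unitary A) : Prop :=
  ∃ φ : reducedCStar G →⋆ₐ[ℂ] A, ∀ g : G, φ (reducedCStar.of g) = (u g : A)

/-! ### Weak containment and the spectral gap property -/

/-- Weak containment `σ ≺ π` of unitary representations of a discrete group `G`: every diagonal
coefficient of `σ` is a pointwise limit (i.e. uniform on finite sets) of finite sums of diagonal
coefficients of `π`. -/
def WeaklyContained {G H₁ H₂ : Type*} [Group G]
    [NormedAddCommGroup H₁] [InnerProductSpace ℂ H₁] [CompleteSpace H₁]
    [NormedAddCommGroup H₂] [InnerProductSpace ℂ H₂] [CompleteSpace H₂]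
    (σ : G →* unitary (H₁ →L[ℂ] H₁)) (π : G →* unitary (H₂ →L[ℂ] H₂)) : Prop :=
  ∀ (ξ : H₁) (F : Finset G) (ε : ℝ), 0 < ε →
    ∃ (n : ℕ) (η : Fin n → H₂), ∀ g ∈ F,
      ‖inner ℂ ξ ((σ g : H₁ →L[ℂ] H₁) ξ)
        - ∑ i, inner ℂ (η i) ((π g : H₂ →L[ℂ] H₂) (η i))‖ < ε

/-- The trivial representation of `G` on `ℂ`. -/
noncomputable def trivialRep (G : Type*) [Group G] : G →* unitary (ℂ →L[ℂ] ℂ) := 1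

/-- The `Λ`-invariant subset `(Γ ⧸ Λ) \ {eΛ}` of `Γ ⧸ Λ`. -/
def nontrivialCosets {Γ : Type*} [Group Γ] (Λ : Subgroup Γ) : SubMulAction Λ (Γ ⧸ Λ) where
  carrier := {x | x ≠ ((1 : Γ) : Γ ⧸ Λ)}
  smul_mem' := by
    intro l x hx h
    apply hx
    have h1 : x = l⁻¹ • ((1 : Γ) : Γ ⧸ Λ) := by rw [← h, inv_smul_smul]
    rw [h1]
    change (((l⁻¹ : Λ) : Γ) * 1 : Γ) = ((1 : Γ) : Γ ⧸ Λ)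
    rw [QuotientGroup.eq]
    simp

/-- The subgroup `Λ` of `Γ` has the spectral gap property if the representation of `Λ` on
`ℓ²((Γ ⧸ Λ) \ {eΛ})` does not weakly contain the trivial representation. -/
def HasSpectralGapProperty {Γ : Type*} [Group Γ] (Λ : Subgroup Γ) : Prop :=
  ¬ WeaklyContained (trivialRep Λ) (permRep Λ (nontrivialCosets Λ))

/-!
If `Λ` has a finite orbit in `(Γ ⧸ Λ) \ {eΛ}`, its indicator function is an invariant vector, so the
trivial representation is contained in the permutation representation. The substance is the
converse, which rests on a Fredholm argument.

Since `Λ` is not amenable, `ℓ²(Λ)` has no almost invariant vectors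
(`isAmenableGroup_of_hasAlmostInvariantVectors`: an ultralimit of the densities `|ξᵢ|²` would be an
invariant mean). Hence for some finite `F ⊆ Λ` the Laplacian `∑ g ∈ F, (1 - λ(g))* (1 - λ(g))` is
bounded below, so it is invertible, and by spectral permanence its inverse lies in `C*_λ(Λ)`
(`exists_isUnit_reducedCStar_laplacian`). Temperedness carries it to an invertible element of the
Calkin algebra of `ℓ²(Γ ⧸ Λ)`: any ring homomorphism preserves invertibility, so this step needs
no norm estimate in the Calkin algebra. So the corresponding operator `T` on `ℓ²(Γ ⧸ Λ)` satisfies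
`S T = 1 + K` with `K` compact.

If the spectral gap property fails, there are almost invariant unit vectors `ηᵢ` supported away
from `eΛ` (`hasAlmostInvariantVectors_of_weaklyContained`). Then `T ηᵢ → 0`, so `ηᵢ + K ηᵢ → 0`, and
compactness of `K` makes `ηᵢ` converge in norm along an ultrafilter. The limit is an invariant unit
vector vanishing at `eΛ` (`HasAlmostInvariantVectors.exists_invariant_of_leftInverse`). It is a
nonzero constant on some orbit in `(Γ ⧸ Λ) \ {eΛ}`, and square-summability forces this orbit to be
finite.
-/

open Filter Topology

/-! ### Almost invariant vectors -/

/-- A unitary representation has almost invariant vectors if for every finite set of group elements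
and every `ε > 0` there is a unit vector moved by less than `ε` by each of these elements. -/
def HasAlmostInvariantVectors {G H : Type*} [Group G] [NormedAddCommGroup H]
    [InnerProductSpace ℂ H] [CompleteSpace H] (π : G →* unitary (H →L[ℂ] H)) : Prop :=
  ∀ (F : Finset G) (ε : ℝ), 0 < ε →
    ∃ ξ : H, ‖ξ‖ = 1 ∧ ∀ g ∈ F, ‖(π g : H →L[ℂ] H) ξ - ξ‖ < ε

section AlmostInvariant

variable {G H : Type*} [Group G] [NormedAddCommGroup H] [InnerProductSpace ℂ H] [CompleteSpace H]
  {π : G →* unitary (H →L[ℂ] H)}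

/-- The index set `Finset G × ℕ` records a finite set of group elements and a tolerance
`1 / (n + 1)`, so that neither countability nor infiniteness of `G` is required. -/
theorem HasAlmostInvariantVectors.exists_ultrafilter (h : HasAlmostInvariantVectors π) :
    ∃ (U : Ultrafilter (Finset G × ℕ)) (η : Finset G × ℕ → H), (∀ i, ‖η i‖ = 1) ∧
      ∀ g, Tendsto (fun i => (π g : H →L[ℂ] H) (η i) - η i) U (𝓝 0) := by
  classical
  have hpos : ∀ i : Finset G × ℕ, (0 : ℝ) < 1 / ((i.2 : ℝ) + 1) := fun i => by positivity
  choose η hη1 hη using fun i : Finset G × ℕ => h i.1 _ (hpos i)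
  refine ⟨Ultrafilter.of atTop, η, hη1, fun g => ?_⟩
  refine Tendsto.mono_left ?_ (Ultrafilter.of_le _)
  rw [tendsto_zero_iff_norm_tendsto_zero]
  have hlim : Tendsto (fun i : Finset G × ℕ => 1 / ((i.2 : ℝ) + 1)) atTop (𝓝 0) := by
    rw [← prod_atTop_atTop_eq]
    exact tendsto_one_div_add_atTop_nhds_zero_nat.comp tendsto_snd
  refine squeeze_zero' (Eventually.of_forall fun i => norm_nonneg _) ?_ hlim
  filter_upwards [eventually_ge_atTop (({g}, 0) : Finset G × ℕ)] with i hi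
  exact (hη i g (by simpa using hi.1)).le

theorem norm_sub_sq_eq_re_inner (g : G) (ξ : H) :
    ‖(π g : H →L[ℂ] H) ξ - ξ‖ ^ 2
      = 2 * (‖ξ‖ ^ 2 - RCLike.re (inner ℂ ξ ((π g : H →L[ℂ] H) ξ))) := by
  rw [@norm_sub_sq ℂ, Unitary.norm_map, ← inner_conj_symm ξ, RCLike.conj_re]
  ring

theorem inner_one_sub_mul_one_sub (g : G) (ξ : H) :
    inner ℂ ((((1 : H →L[ℂ] H) - (π g⁻¹ : H →L[ℂ] H)) * (1 - (π g : H →L[ℂ] H))) ξ) ξ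
      = ((‖(π g : H →L[ℂ] H) ξ - ξ‖ ^ 2 : ℝ) : ℂ) := by
  have hstar : ((1 : H →L[ℂ] H) - (π g⁻¹ : H →L[ℂ] H))
      = star ((1 : H →L[ℂ] H) - (π g : H →L[ℂ] H)) := by
    rw [map_inv, star_sub, star_one]
    rfl
  rw [hstar, ContinuousLinearMap.star_eq_adjoint, mul_apply_eq_comp,
    ContinuousLinearMap.adjoint_inner_left, inner_self_eq_norm_sq_to_K, norm_sub_rev]
  simp

/-- By `norm_sub_sq_eq_re_inner`, squared displacements are linear in the diagonal coefficients. If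
the coefficients of a finite family of vectors add up to almost `1` at every `g ∈ F`, then averaging
over the family finds a member that each `g ∈ F` moves little relative to its norm. -/
theorem hasAlmostInvariantVectors_of_weaklyContained
    (h : WeaklyContained (trivialRep G) π) : HasAlmostInvariantVectors π := by
  classical
  intro F ε hε
  set N : ℝ := (F.card : ℝ) with hN
  have hN0 : 0 ≤ N := Nat.cast_nonneg _
  -- `δ` is chosen such that `δ < 1` and `4 δ N < ε² (1 - δ)`.
  obtain ⟨δ, hδ0, hδ⟩ : ∃ δ : ℝ, 0 < δ ∧ δ * (4 * N + ε ^ 2 + 1) = ε ^ 2 / (1 + ε ^ 2) := by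
    refine ⟨ε ^ 2 / (1 + ε ^ 2) / (4 * N + ε ^ 2 + 1), by positivity, ?_⟩
    field_simp
  have hlt1 : ε ^ 2 / (1 + ε ^ 2) < 1 := by
    rw [div_lt_one (by positivity)]; linarith
  have hlt2 : ε ^ 2 / (1 + ε ^ 2) ≤ ε ^ 2 := by
    apply div_le_self (by positivity); nlinarith [sq_nonneg ε]
  have hδ1 : δ < 1 := by nlinarith [mul_nonneg hδ0.le hN0, mul_nonneg hδ0.le (sq_nonneg ε)]
  have hδ2 : 4 * δ * N < ε ^ 2 * (1 - δ) := by nlinarith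
  obtain ⟨n, η, hη⟩ := h 1 (insert 1 F) δ hδ0
  have hre : ∀ g ∈ insert 1 F,
      |1 - ∑ i, RCLike.re (inner ℂ (η i) ((π g : H →L[ℂ] H) (η i)))| < δ := by
    intro g hg
    refine lt_of_le_of_lt ?_ (hη g hg)
    refine le_trans (le_of_eq ?_) (RCLike.abs_re_le_norm _)
    rw [map_sub, map_sum]
    simp [trivialRep]
  -- The coefficients at the identity are the squared norms.
  have hone : |1 - ∑ i, ‖η i‖ ^ 2| < δ := by
    have := hre 1 (Finset.mem_insert_self _ _)
    simpa only [map_one, OneMemClass.coe_one, one_apply_eq_self, inner_self_eq_norm_sq] using this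
  have hg : ∀ g ∈ F, ∑ i, ‖(π g : H →L[ℂ] H) (η i) - η i‖ ^ 2 ≤ 4 * δ := by
    intro g hg
    have h1 := abs_lt.1 (hre g (Finset.mem_insert_of_mem hg))
    have h2 := abs_lt.1 hone
    simp only [norm_sub_sq_eq_re_inner, ← Finset.mul_sum, Finset.sum_sub_distrib]
    linarith [h1.1, h1.2, h2.1, h2.2]
  have htot : ∑ i, ∑ g ∈ F, ‖(π g : H →L[ℂ] H) (η i) - η i‖ ^ 2
      < ∑ i, ε ^ 2 * ‖η i‖ ^ 2 := by
    rw [Finset.sum_comm, ← Finset.mul_sum]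
    have h1 := Finset.sum_le_card_nsmul F _ _ hg
    rw [nsmul_eq_mul, ← hN] at h1
    have h2 : ε ^ 2 * (1 - δ) ≤ ε ^ 2 * ∑ i, ‖η i‖ ^ 2 := by
      have := (abs_lt.1 hone).2
      gcongr
      linarith
    linarith
  obtain ⟨i, -, hi⟩ := Finset.exists_lt_of_sum_lt htot
  have hne : 0 < ‖η i‖ := by
    rw [norm_pos_iff]
    rintro h0
    simp [h0] at hi
  refine ⟨((‖η i‖ : ℂ)⁻¹) • η i, ?_, fun g hgF => ?_⟩
  · rw [norm_smul, norm_inv, Complex.norm_real, norm_norm, inv_mul_cancel₀ hne.ne']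
  · have h1 : ‖(π g : H →L[ℂ] H) (η i) - η i‖ ^ 2 < (ε * ‖η i‖) ^ 2 := by
      rw [mul_pow]
      refine lt_of_le_of_lt ?_ hi
      exact Finset.single_le_sum (f := fun g => ‖(π g : H →L[ℂ] H) (η i) - η i‖ ^ 2)
        (fun _ _ => by positivity) hgF
    have h2 := lt_of_pow_lt_pow_left₀ 2 (by positivity) h1
    rw [map_smul, ← smul_sub, norm_smul, norm_inv, Complex.norm_real, norm_norm, inv_mul_lt_iff₀ hne]
    linarith

/-- If there are no almost invariant vectors, then some Laplacian
`∑ g ∈ F, (1 - π(g))* (1 - π(g))` is bounded below by a positive constant. -/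
theorem exists_isUnit_laplacian_of_not_hasAlmostInvariantVectors
    (h : ¬ HasAlmostInvariantVectors π) :
    ∃ F : Finset G, IsUnit
      (∑ g ∈ F, (1 - (π g⁻¹ : H →L[ℂ] H)) * (1 - (π g : H →L[ℂ] H))) := by
  unfold HasAlmostInvariantVectors at h
  push Not at h
  obtain ⟨F, ε, hε, hF⟩ := h
  refine ⟨F, ContinuousLinearMap.isUnit_of_forall_le_norm_inner_map _
    (c := ⟨ε ^ 2, by positivity⟩) (NNReal.coe_pos.1 (pow_pos hε 2)) fun ξ => ?_⟩
  rw [sum_apply, sum_inner, Finset.sum_congr rfl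
    (fun g _ => inner_one_sub_mul_one_sub (π := π) g ξ), ← Complex.ofReal_sum, Complex.norm_real,
    Real.norm_of_nonneg (Finset.sum_nonneg fun _ _ => by positivity)]
  change ‖ξ‖ ^ 2 * ε ^ 2 ≤ _
  rcases eq_or_ne ξ 0 with rfl | hξ
  · simp
  have hpos : 0 < ‖ξ‖ := norm_pos_iff.2 hξ
  obtain ⟨g, hgF, hg⟩ := hF (((‖ξ‖ : ℂ)⁻¹) • ξ) (by
    rw [norm_smul, norm_inv, Complex.norm_real, norm_norm, inv_mul_cancel₀ hpos.ne'])
  rw [map_smul, ← smul_sub, norm_smul, norm_inv, Complex.norm_real, norm_norm,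
    le_inv_mul_iff₀ hpos] at hg
  calc ‖ξ‖ ^ 2 * ε ^ 2 = (‖ξ‖ * ε) ^ 2 := by ring
    _ ≤ ‖(π g : H →L[ℂ] H) ξ - ξ‖ ^ 2 := by gcongr
    _ ≤ _ := Finset.single_le_sum (f := fun g => ‖(π g : H →L[ℂ] H) ξ - ξ‖ ^ 2)
        (fun _ _ => by positivity) hgF

end AlmostInvariant

/-! ### Reiter's criterion: almost invariant vectors in `ℓ²(G)` imply amenability -/

theorem memEllTwo_indicator {X : Type*} (A : Set X) {f : X → ℂ} (hf : Memℓp f 2) :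
    Memℓp (A.indicator f) 2 := by
  have h2 : 0 < (2 : ENNReal).toReal := by norm_num
  rw [memℓp_gen_iff h2] at hf ⊢
  refine (hf.indicator A).congr fun x => ?_
  by_cases hx : x ∈ A <;> simp [hx]

/-- The truncation `1_A ξ` of a square-summable function to a set `A`. -/
noncomputable def truncate {X : Type*} (A : Set X) (ξ : EllTwo X) : EllTwo X :=
  ⟨A.indicator ξ, memEllTwo_indicator A (lp.memℓp ξ)⟩

theorem truncate_apply {X : Type*} (A : Set X) (ξ : EllTwo X) (x : X) :
    truncate A ξ x = A.indicator ξ x := rfl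

theorem EllTwo.hasSum_norm_sq {X : Type*} (ξ : EllTwo X) :
    HasSum (fun x => ‖ξ x‖ ^ 2) (‖ξ‖ ^ 2) := by
  have h := lp.hasSum_norm (p := 2) (by norm_num) ξ
  simpa using h

theorem hasSum_truncate {X : Type*} (A : Set X) (ξ : EllTwo X) :
    HasSum (A.indicator fun x => ‖ξ x‖ ^ 2) (‖truncate A ξ‖ ^ 2) := by
  convert EllTwo.hasSum_norm_sq (truncate A ξ) using 1
  funext x
  by_cases hx : x ∈ A <;> simp [truncate_apply, hx]

theorem norm_truncate_le {X : Type*} (A : Set X) (ξ : EllTwo X) : ‖truncate A ξ‖ ≤ ‖ξ‖ := by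
  refine le_of_sq_le_sq ?_ (norm_nonneg _)
  exact hasSum_le (fun x => Set.indicator_le_self' (fun _ _ => by positivity) x)
    (hasSum_truncate A ξ) (EllTwo.hasSum_norm_sq ξ)

theorem truncate_sub {X : Type*} (A : Set X) (ξ η : EllTwo X) :
    truncate A (ξ - η) = truncate A ξ - truncate A η := by
  ext x
  change A.indicator (fun x => ξ x - η x) x = A.indicator ξ x - A.indicator η x
  by_cases hx : x ∈ A <;> simp [hx]

/-- Translating the set by `g` amounts to translating the vector by `g⁻¹`. -/
theorem norm_truncate_image_mul {G : Type*} [Group G] (g : G) (A : Set G) (ξ : EllTwo G) :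
    ‖truncate ((fun x => g * x) '' A) ξ‖
      = ‖truncate A ((permRep G G g⁻¹ : EllTwo G →L[ℂ] EllTwo G) ξ)‖ := by
  refine (sq_eq_sq₀ (norm_nonneg _) (norm_nonneg _)).1 ?_
  refine (hasSum_truncate _ ξ).unique ?_
  rw [← (Equiv.mulLeft g).hasSum_iff]
  convert hasSum_truncate A _ using 1
  funext x
  have hx' : (permRep G G g⁻¹ : EllTwo G →L[ℂ] EllTwo G) ξ x = ξ (g * x) := by
    rw [permRep_apply, inv_inv, smul_eq_mul]
  by_cases hx : x ∈ A <;> simp only [Function.comp_apply, Equiv.coe_mulLeft] <;>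
    simp [hx, hx', -map_inv]

theorem abs_norm_truncate_sq_sub_le {X : Type*} (A : Set X) {ξ η : EllTwo X} (hξ : ‖ξ‖ = 1)
    (hη : ‖η‖ = 1) : |‖truncate A ξ‖ ^ 2 - ‖truncate A η‖ ^ 2| ≤ 2 * ‖ξ - η‖ := by
  have h1 := abs_norm_sub_norm_le (truncate A ξ) (truncate A η)
  rw [← truncate_sub] at h1
  have h2 := h1.trans (norm_truncate_le A (ξ - η))
  have h3 := norm_truncate_le A ξ
  have h4 := norm_truncate_le A η
  rw [sq_sub_sq, abs_mul, abs_of_nonneg (by positivity)]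
  gcongr
  linarith

/-- For almost invariant unit vectors `ηᵢ`, the limit along an ultrafilter of the probability measures
with densities `|ηᵢ|²` is a left-invariant mean. -/
theorem isAmenableGroup_of_hasAlmostInvariantVectors {G : Type*} [Group G]
    (h : HasAlmostInvariantVectors (permRep G G)) : IsAmenableGroup G := by
  obtain ⟨U, η, hη1, hη⟩ := h.exists_ultrafilter
  have hlim : ∀ A : Set G, ∃ c : ℝ, Tendsto (fun i => ‖truncate A (η i)‖ ^ 2) U (𝓝 c) := by
    intro A
    obtain ⟨c, -, hc⟩ := (isCompact_Icc (a := (0 : ℝ)) (b := 1)).ultrafilter_le_nhds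
      (U.map fun i => ‖truncate A (η i)‖ ^ 2) (by
        rw [Ultrafilter.coe_map, le_principal_iff, mem_map]
        refine Filter.univ_mem' fun i => ⟨by positivity, ?_⟩
        exact pow_le_one₀ (norm_nonneg _) ((norm_truncate_le _ _).trans (hη1 i).le))
    exact ⟨c, hc⟩
  choose m hm using hlim
  refine ⟨m, fun A => ?_, ?_, fun A B hAB => ?_, fun g A => ?_⟩
  · exact ge_of_tendsto' (hm A) fun i => by positivity
  · refine tendsto_nhds_unique (hm Set.univ) ?_
    have : ∀ i, ‖truncate Set.univ (η i)‖ ^ 2 = 1 := fun i => by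
      have : truncate Set.univ (η i) = η i := by ext x; simp [truncate_apply]
      rw [this, hη1, one_pow]
    simp only [this]
    exact tendsto_const_nhds
  · refine tendsto_nhds_unique (hm (A ∪ B)) ?_
    refine ((hm A).add (hm B)).congr fun i => ?_
    refine ((hasSum_truncate A (η i)).add (hasSum_truncate B (η i))).unique ?_
    convert hasSum_truncate (A ∪ B) (η i) using 1
    exact (Set.indicator_union_of_disjoint hAB _).symm
  · have h0 : Tendsto (fun i => ‖truncate ((fun x => g * x) '' A) (η i)‖ ^ 2
        - ‖truncate A (η i)‖ ^ 2) U (𝓝 0) := by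
      refine squeeze_zero_norm (fun i => ?_) 
        (by simpa only [norm_zero, mul_zero] using (hη g⁻¹).norm.const_mul (2 : ℝ))
      rw [Real.norm_eq_abs, norm_truncate_image_mul]
      refine abs_norm_truncate_sq_sub_le A ?_ (hη1 i)
      rw [Unitary.norm_map, hη1]
    have h1 := tendsto_nhds_unique ((hm _).sub (hm A)) h0
    linarith

/-! ### Passing to the Calkin algebra -/

/-- Kesten's criterion inside the reduced C*-algebra: the inverse of a Laplacian of the regular
representation lies in `C*_λ(G)` by spectral permanence. -/
theorem exists_isUnit_reducedCStar_laplacian {G : Type*} [Group G] (hG : ¬ IsAmenableGroup G) :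
    ∃ F : Finset G, IsUnit
      (∑ g ∈ F, (1 - reducedCStar.of g⁻¹) * (1 - reducedCStar.of g) : reducedCStar G) := by
  obtain ⟨F, hF⟩ := exists_isUnit_laplacian_of_not_hasAlmostInvariantVectors
    (mt isAmenableGroup_of_hasAlmostInvariantVectors hG)
  have : IsClosed (reducedCStar G : Set (EllTwo G →L[ℂ] EllTwo G)) :=
    StarSubalgebra.isClosed_topologicalClosure _
  refine ⟨F, (StarSubalgebra.coe_isUnit (reducedCStar G)).1 ?_⟩
  convert hF using 1
  rw [AddSubmonoidClass.coe_finsetSum]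
  rfl

/-- A tempered Calkin representation of a non-amenable group sends some Laplacian to an invertible
element, so this Laplacian has a left inverse modulo the compact operators. -/
theorem exists_leftInverse_laplacian_of_isTemperedRep {G X : Type*} [Group G] [MulAction G X]
    (hG : ¬ IsAmenableGroup G) (htemp : IsTemperedRep (calkinRep G X)) :
    ∃ (F : Finset G) (S : EllTwo X →L[ℂ] EllTwo X), IsCompactOperator
      (S * (∑ g ∈ F, (1 - (permRep G X g⁻¹ : EllTwo X →L[ℂ] EllTwo X))
        * (1 - (permRep G X g : EllTwo X →L[ℂ] EllTwo X))) - 1 : EllTwo X →L[ℂ] EllTwo X) := by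
  obtain ⟨φ, hφ⟩ := htemp
  obtain ⟨F, hF⟩ := exists_isUnit_reducedCStar_laplacian hG
  obtain ⟨s, hs⟩ := (hF.map φ).exists_left_inv
  obtain ⟨S, rfl⟩ := Ideal.Quotient.mk_surjective s
  refine ⟨F, S, ?_⟩
  change _ ∈ compactIdeal (EllTwo X)
  rw [← Ideal.Quotient.eq, map_mul, map_one, ← hs]
  congr 1
  simp only [map_sum, map_mul, map_sub, map_one, hφ, calkinRep_apply]
  rfl

/-- Let `T` be a Laplacian of `π` with a left inverse `S` modulo the compact operators. If `ηᵢ` are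
almost invariant unit vectors of a subrepresentation, then `T ηᵢ → 0`, so `ηᵢ` and
`-(S T - 1) ηᵢ` have the same limit, which exists along an ultrafilter because `S T - 1` is
compact. -/
theorem HasAlmostInvariantVectors.exists_invariant_of_leftInverse {G H K : Type*} [Group G]
    [NormedAddCommGroup H] [InnerProductSpace ℂ H] [CompleteSpace H]
    [NormedAddCommGroup K] [InnerProductSpace ℂ K] [CompleteSpace K]
    {ρ : G →* unitary (H →L[ℂ] H)} {π : G →* unitary (K →L[ℂ] K)} (ι : H →ₗᵢ[ℂ] K)
    (hι : ∀ g ξ, ι ((ρ g : H →L[ℂ] H) ξ) = (π g : K →L[ℂ] K) (ι ξ))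
    (h : HasAlmostInvariantVectors ρ) {F : Finset G} {S : K →L[ℂ] K}
    (hS : IsCompactOperator (S * (∑ g ∈ F, (1 - (π g⁻¹ : K →L[ℂ] K))
        * (1 - (π g : K →L[ℂ] K))) - 1 : K →L[ℂ] K)) :
    ∃ ζ ∈ closure (Set.range ι), ‖ζ‖ = 1 ∧ ∀ g, (π g : K →L[ℂ] K) ζ = ζ := by
  obtain ⟨U, η, hη1, hη⟩ := h.exists_ultrafilter
  have hιη : ∀ g, Tendsto (fun i => (π g : K →L[ℂ] K) (ι (η i)) - ι (η i)) U (𝓝 0) := by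
    intro g
    have := (ι.continuous.tendsto 0).comp (hη g)
    simpa [Function.comp_def, hι] using this
  set T : K →L[ℂ] K := ∑ g ∈ F, (1 - (π g⁻¹ : K →L[ℂ] K)) * (1 - (π g : K →L[ℂ] K)) with hT
  have hTη : Tendsto (fun i => T (ι (η i))) U (𝓝 0) := by
    simp only [hT, sum_apply]
    rw [← Finset.sum_const_zero (s := F)]
    refine tendsto_finsetSum _ fun g _ => ?_
    have := ((1 - (π g⁻¹ : K →L[ℂ] K)).continuous.tendsto _).comp (hιη g).neg
    simpa [Function.comp_def] using this
  obtain ⟨z, -, hz⟩ := (hS.isCompact_closure_image_closedBall 1).ultrafilter_le_nhds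
    (U.map fun i => (S * T - 1 : K →L[ℂ] K) (ι (η i))) (by
      rw [Ultrafilter.coe_map, le_principal_iff, mem_map]
      refine Filter.univ_mem' fun i => subset_closure ⟨ι (η i), ?_, rfl⟩
      simp [hη1])
  have hz' : Tendsto (fun i => (S * T - 1 : K →L[ℂ] K) (ι (η i))) U (𝓝 z) := hz
  have hlim : Tendsto (fun i => ι (η i)) U (𝓝 (-z)) := by
    have h1 := ((S.continuous.tendsto 0).comp hTη).sub hz'
    simpa [Function.comp_def] using h1
  refine ⟨-z, mem_closure_of_tendsto hlim (Eventually.of_forall fun i => ⟨_, rfl⟩), ?_, fun g => ?_⟩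
  · refine tendsto_nhds_unique hlim.norm ?_
    simp [hη1]
  · have h1 := (((π g : K →L[ℂ] K).continuous.tendsto _).comp hlim).sub hlim
    exact sub_eq_zero.1 (tendsto_nhds_unique h1 (hιη g))

/-! ### Extension by zero and invariant vectors of permutation representations -/

theorem memEllTwo_extend {X Y : Type*} {f : Y → X} (hf : f.Injective) {ξ : Y → ℂ}
    (hξ : Memℓp ξ 2) : Memℓp (Function.extend f ξ 0) 2 := by
  have h2 : 0 < (2 : ENNReal).toReal := by norm_num
  rw [memℓp_gen_iff h2] at hξ ⊢
  convert ((hasSum_extend_zero hf).2 hξ.hasSum).summable using 2 with x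
  rw [Function.apply_extend (fun z : ℂ => ‖z‖ ^ (2 : ENNReal).toReal)]
  congr 1
  funext x
  simp

/-- Extension by zero `ℓ²(Y) → ℓ²(X)` along an injective map `Y → X`. -/
noncomputable def extendByZero {X Y : Type*} (f : Y → X) (hf : f.Injective) :
    EllTwo Y →ₗᵢ[ℂ] EllTwo X where
  toFun ξ := ⟨Function.extend f ξ 0, memEllTwo_extend hf (lp.memℓp ξ)⟩
  map_add' ξ η := by
    ext x
    change Function.extend f (fun y => ξ y + η y) 0 x
      = Function.extend f ξ 0 x + Function.extend f η 0 x
    by_cases hx : ∃ y, f y = x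
    · obtain ⟨y, rfl⟩ := hx
      simp only [hf.extend_apply]
    · simp [Function.extend_apply' _ _ _ hx]
  map_smul' c ξ := by
    ext x
    change Function.extend f (fun y => c * ξ y) 0 x = c * Function.extend f ξ 0 x
    by_cases hx : ∃ y, f y = x
    · obtain ⟨y, rfl⟩ := hx
      simp only [hf.extend_apply]
    · simp [Function.extend_apply' _ _ _ hx]
  norm_map' ξ := by
    refine (sq_eq_sq₀ (norm_nonneg _) (norm_nonneg _)).1 ?_
    refine (EllTwo.hasSum_norm_sq _).unique ?_
    convert (hasSum_extend_zero hf).2 (EllTwo.hasSum_norm_sq ξ) using 1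
    funext x
    change ‖Function.extend f ξ 0 x‖ ^ 2 = _
    rw [Function.apply_extend (fun z : ℂ => ‖z‖ ^ 2)]
    congr 1
    funext x
    simp

theorem extendByZero_apply {X Y : Type*} (f : Y → X) (hf : f.Injective) (ξ : EllTwo Y) (x : X) :
    extendByZero f hf ξ x = Function.extend f ξ 0 x := rfl

theorem extendByZero_permRep {G X : Type*} [Group G] [MulAction G X] (Y : SubMulAction G X) (g : G)
    (ξ : EllTwo Y) :
    extendByZero (Subtype.val : Y → X) Subtype.val_injective
        ((permRep G Y g : EllTwo Y →L[ℂ] EllTwo Y) ξ)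
      = (permRep G X g : EllTwo X →L[ℂ] EllTwo X)
        (extendByZero (Subtype.val : Y → X) Subtype.val_injective ξ) := by
  ext x
  rw [permRep_apply, extendByZero_apply, extendByZero_apply]
  by_cases hx : x ∈ Y
  · lift x to Y using hx
    rw [← SubMulAction.val_smul, Subtype.val_injective.extend_apply,
      Subtype.val_injective.extend_apply, permRep_apply]
  · rw [Function.extend_apply' _ _ _ (by simpa using hx), Function.extend_apply' _ _ _ ?_]
    · rfl
    · rintro ⟨y, hy⟩
      exact hx (by simpa [hy] using Y.smul_mem g y.2)

/-- An invariant vector is constant on orbits, and square-summable. -/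
theorem finite_orbit_of_invariant {G X : Type*} [Group G] [MulAction G X] {ζ : EllTwo X}
    (hζ : ∀ g : G, (permRep G X g : EllTwo X →L[ℂ] EllTwo X) ζ = ζ) {x : X} (hx : ζ x ≠ 0) :
    (MulAction.orbit G x).Finite := by
  have h0 := (EllTwo.hasSum_norm_sq ζ).summable.tendsto_cofinite_zero
  have hlt := h0.eventually (gt_mem_nhds (show (0 : ℝ) < ‖ζ x‖ ^ 2 by positivity))
  refine (eventually_cofinite.1 hlt).subset ?_
  rintro _ ⟨g, rfl⟩
  have h1 : ζ (g • x) = ζ x := by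
    conv_lhs => rw [← hζ g, permRep_apply, inv_smul_smul]
  simp [h1]

/-- The normalized indicator function of a finite orbit is an invariant vector. -/
theorem weaklyContained_trivialRep_of_finite_orbit {G X : Type*} [Group G] [MulAction G X] (x : X)
    (hx : (MulAction.orbit G x).Finite) : WeaklyContained (trivialRep G) (permRep G X) := by
  classical
  have h2 : 0 < (2 : ENNReal).toReal := by norm_num
  have hmem : Memℓp ((MulAction.orbit G x).indicator (1 : X → ℂ)) 2 := by
    rw [memℓp_gen_iff h2]
    refine summable_of_hasFiniteSupport (hx.subset fun y hy => ?_)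
    by_contra hyx
    simp [hyx] at hy
  let χ : EllTwo X := ⟨_, hmem⟩
  have hχ : ∀ g, (permRep G X g : EllTwo X →L[ℂ] EllTwo X) χ = χ := by
    intro g
    ext y
    rw [permRep_apply]
    change (MulAction.orbit G x).indicator (1 : X → ℂ) (g⁻¹ • y)
      = (MulAction.orbit G x).indicator 1 y
    have hiff : g⁻¹ • y ∈ MulAction.orbit G x ↔ y ∈ MulAction.orbit G x := by
      rw [← MulAction.orbit_eq_iff, MulAction.orbit_smul, MulAction.orbit_eq_iff]
    by_cases hy : y ∈ MulAction.orbit G x <;> simp [hiff, hy]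
  have hne : χ ≠ 0 := by
    intro h
    have : χ x = 0 := by rw [h]; rfl
    have h1 : χ x = 1 := by
      change (MulAction.orbit G x).indicator 1 x = (1 : ℂ)
      simp
    simp [h1] at this
  intro ξ F ε hε
  refine ⟨1, fun _ => (ξ * (‖χ‖ : ℂ)⁻¹) • χ, fun g _ => ?_⟩
  have hn : (‖χ‖ : ℂ) ≠ 0 := by simpa using hne
  have : inner ℂ ((ξ * (‖χ‖ : ℂ)⁻¹) • χ)
      ((permRep G X g : EllTwo X →L[ℂ] EllTwo X) ((ξ * (‖χ‖ : ℂ)⁻¹) • χ)) = inner ℂ ξ ξ := by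
    rw [map_smul, hχ, inner_smul_left, inner_smul_right, inner_self_eq_norm_sq_to_K]
    rw [inner_self_eq_norm_sq_to_K, map_mul, map_inv₀, Complex.conj_ofReal]
    have hξ : (starRingEnd ℂ) ξ * ξ = (‖ξ‖ : ℂ) ^ 2 := Complex.conj_mul' ξ
    simp only [Complex.coe_algebraMap]
    field_simp
    linear_combination hξ
  rw [Fin.sum_univ_one, this]
  simpa [trivialRep] using hε

theorem mainTheorem4 {Γ : Type*} [Group Γ] [Countable Γ] (Λ : Subgroup Γ)
    (hΛ : ¬ IsAmenableGroup Λ) (htemp : IsTemperedRep (calkinRep Λ (Γ ⧸ Λ))) :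
    HasSpectralGapProperty Λ ↔
      ∀ g : Γ, g ∉ Λ → (MulAction.orbit Λ (g : Γ ⧸ Λ)).Infinite := by
  constructor
  · intro hgap g hg hfin
    have hmem : (g : Γ ⧸ Λ) ∈ nontrivialCosets Λ := by
      intro h
      rw [QuotientGroup.eq] at h
      exact hg (by simpa using h)
    refine hgap (weaklyContained_trivialRep_of_finite_orbit
      (⟨g, hmem⟩ : nontrivialCosets Λ) ?_)
    refine Set.Finite.of_finite_image (f := Subtype.val) (hfin.subset ?_)
      Subtype.val_injective.injOn
    rintro _ ⟨_, ⟨l, rfl⟩, rfl⟩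
    exact ⟨l, rfl⟩
  · intro horb hweak
    obtain ⟨F, S, hS⟩ := exists_leftInverse_laplacian_of_isTemperedRep hΛ htemp
    obtain ⟨ζ, hζcl, hζ1, hζ⟩ := (hasAlmostInvariantVectors_of_weaklyContained
      hweak).exists_invariant_of_leftInverse _ (extendByZero_permRep (nontrivialCosets Λ)) hS
    -- Evaluation at the trivial coset is continuous, so it vanishes on the closure.
    have hζe : ζ ((1 : Γ) : Γ ⧸ Λ) = 0 := by
      have hcl : IsClosed {ξ : EllTwo (Γ ⧸ Λ) | ξ ((1 : Γ) : Γ ⧸ Λ) = 0} :=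
        isClosed_eq ((lp.evalCLM ℂ (fun _ : Γ ⧸ Λ => ℂ) (p := 2) _).continuous) continuous_const
      refine closure_minimal ?_ hcl hζcl
      rintro _ ⟨ξ, rfl⟩
      refine Function.extend_apply' _ _ _ ?_
      rintro ⟨y, hy⟩
      exact y.2 hy
    obtain ⟨x, hx⟩ : ∃ x, ζ x ≠ 0 := by
      by_contra! h
      have : ζ = 0 := by ext x; exact h x
      simp [this] at hζ1
    obtain ⟨g, rfl⟩ := QuotientGroup.mk_surjective x
    refine horb g (fun hg => hx ?_) (finite_orbit_of_invariant hζ hx)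
    rwa [show (g : Γ ⧸ Λ) = ((1 : Γ) : Γ ⧸ Λ) from QuotientGroup.eq.2 (by simpa using hg)]
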